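/- Let $n\ge 0$, $\mathcal B=\{0,1\}^n$, and let $f:\mathcal B\to\mathbb R$ be submodular, i.e. $f(x\vee y)+f(x\wedge y)\le f(x)+f(y)$ for all $x,y\in\mathcal B$ (entrywise maximum and minimum), with $f(\mathbf 0)=0$. Let $\mathrm{hyp}_{\mathcal B}(f)=\{(x,t)\in\mathcal B\times\mathbb R: t\le f(x)\}$. A set $\mathcal C\subseteq\mathbb R^{n}\times\mathbb R$ is $\mathcal S$-free if it is closed and convex and $\operatorname{int}(\mathcal C)\cap\mathcal S=\varnothing$; it is maximally $\mathcal S$-free if, in addition, no $\mathcal S$-free set properly contains it. For a permutation $\pi$ of $\{1,\dots,n\}$ and $0\le i\le n$ let $v^i(\pi)\in\mathcal B$ be the characteristic vector of $\{\pi(1),\dots,\pi(i)\}$, let $V(\pi)=\{v^0(\pi),\dots,v^n(\pi)\}$, and let $\sigma(\pi)\in\mathbb R^n$ be given by $\sigma(\pi)_{\pi(i)}=f(v^i(\pi))-f(v^{i-1}(\pi))$ for $1\le i\le n$. For a set $\Pi'$ of permutations let $\mathcal C(\Pi')=\{(x,t)\in\mathbb R^n\times\mathbb R:\ \sigma(\pi)x\le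 t\ \text{ for all }\pi\in\Pi'\}$. Call $\Pi'$ a cover if $\bigcup_{\pi\in\Pi'}V(\pi)=\mathcal B$, and a minimal cover if, in addition, $V(\pi)\setminus\bigcup_{\pi'\in\Pi',\,\pi'\ne\pi}V(\pi')\neq\varnothing$ for every $\pi\in\Pi'$. Let $\Pi'$ be any set of permutations of $\{1,\dots,n\}$. If $\Pi'$ is a cover, then $\mathcal C(\Pi')$ is $\mathrm{hyp}_{\mathcal B}(f)$-free. Suppose moreover that $f$ is non-degenerate in the sense that $\pi\mapsto\sigma(\pi)$ is injective (distinct permutations give distinct inequalities $\sigma(\pi)x\le t$). Then: 1. $\mathcal C(\Pi')$ is $\mathrm{hyp}_{\mathcal B}(f)$-free if and only if $\Pi'$ is a cover; 2. $\mathcal C(\Pi')$ is maximally $\mathrm{hyp}_{\mathcal B}(f)$-free if and only if $\Pi'$ is a minimal cover. -/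

import Mathlib

namespace SubmodCut

/-- The Boolean hypercube `{0,1}^n`, as a set of vectors of `ℝ^n`. -/
def cube (n : ℕ) : Set (Fin n → ℝ) := {x | ∀ i, x i = 0 ∨ x i = 1}

/-- Submodularity over the Boolean hypercube; `⊔` and `⊓` are the entrywise maximum and minimum.
Only the values of `f` on `{0,1}^n` matter. -/
def Submodular {n : ℕ} (f : (Fin n → ℝ) → ℝ) : Prop :=
  ∀ x ∈ cube n, ∀ y ∈ cube n, f (x ⊔ y) + f (x ⊓ y) ≤ f x + f y

/-- The hypograph of `f` over a set `D`. -/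
def hypograph {n : ℕ} (D : Set (Fin n → ℝ)) (f : (Fin n → ℝ) → ℝ) : Set ((Fin n → ℝ) × ℝ) :=
  {p | p.1 ∈ D ∧ p.2 ≤ f p.1}

/-- `C` is an `S`-free set: closed, convex, with no point of `S` in its interior. -/
def IsFree {n : ℕ} (S C : Set ((Fin n → ℝ) × ℝ)) : Prop :=
  IsClosed C ∧ Convex ℝ C ∧ interior C ∩ S = ∅

/-- `C` is a maximal `S`-free set, with respect to inclusion. -/
def IsMaximallyFree {n : ℕ} (S C : Set ((Fin n → ℝ) × ℝ)) : Prop :=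
  IsFree S C ∧ ∀ C' : Set ((Fin n → ℝ) × ℝ), IsFree S C' → C ⊆ C' → C' = C

/-- `chainPt π i` is the characteristic vector of the set of the first `i` values of `π`. -/
noncomputable def chainPt {n : ℕ} (π : Equiv.Perm (Fin n)) (i : ℕ) : Fin n → ℝ :=
  Set.indicator (π '' {j : Fin n | (j : ℕ) < i}) 1

/-- The monotone chain `V(π)` of a permutation `π`: its points for `i = 0, …, n`. -/
def chain {n : ℕ} (π : Equiv.Perm (Fin n)) : Set (Fin n → ℝ) :=
  {x | ∃ i : ℕ, i ≤ n ∧ x = chainPt π i}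

/-- The vector `σ(π)`, see `sigma_apply` (positions are counted from `0`). -/
noncomputable def sigma {n : ℕ} (f : (Fin n → ℝ) → ℝ) (π : Equiv.Perm (Fin n)) : Fin n → ℝ :=
  fun k => f (chainPt π ((π.symm k : ℕ) + 1)) - f (chainPt π (π.symm k : ℕ))

theorem sigma_apply {n : ℕ} (f : (Fin n → ℝ) → ℝ) (π : Equiv.Perm (Fin n)) (i : Fin n) :
    sigma f π (π i) = f (chainPt π ((i : ℕ) + 1)) - f (chainPt π (i : ℕ)) := by
  simp [sigma]

/-- The polyhedron `C(P) = {(x,t) : σ(π) x ≤ t for all π ∈ P}`. -/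
def polyC {n : ℕ} (f : (Fin n → ℝ) → ℝ) (P : Set (Equiv.Perm (Fin n))) :
    Set ((Fin n → ℝ) × ℝ) :=
  {p | ∀ π ∈ P, ∑ k, sigma f π k * p.1 k ≤ p.2}

/-- `P` is a cover: the monotone chains of its members cover `{0,1}^n`. -/
def IsCover {n : ℕ} (P : Set (Equiv.Perm (Fin n))) : Prop :=
  ⋃ π ∈ P, chain π = cube n

/-- `P` is a minimal cover: each member's chain has a point on no chain of another member. -/
def IsMinimalCover {n : ℕ} (P : Set (Equiv.Perm (Fin n))) : Prop :=
  IsCover P ∧ ∀ π ∈ P, (chain π \ ⋃ π' ∈ {ρ | ρ ∈ P ∧ ρ ≠ π}, chain π').Nonempty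

end SubmodCut

/-! `σ(π)` is Edmonds' greedy vector: `σ(π)x ≤ f x` on the cube, with equality on the chain of `π`.
The interior of `C(P)` is cut out by the strict inequalities, so a cover leaves no point of the
hypograph inside. Injectivity of `sigma f` forces strict submodularity, hence strict inequality off
the chain (`sum_sigma_lt`); an uncovered `x` then puts `(x, f x)` in the interior. Every inequality
is also irredundant (`polyC_ne_of_mem`), so a superfluous permutation can be dropped to get a larger
free set. Conversely, a private chain point of each `π` blocks any enlargement across the inequality
of `π`. -/

open Set Filter Topology

namespace SubmodCut

variable {n : ℕ}

/-- The set function `S ↦ f (1_S)`. -/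
noncomputable def setFun (f : (Fin n → ℝ) → ℝ) (S : Set (Fin n)) : ℝ := f (S.indicator 1)

/-! ### Initial segments of permutations and points of the cube. -/

/-- The set of the first `i` values of `π`. -/
def prefixSet (π : Equiv.Perm (Fin n)) (i : ℕ) : Set (Fin n) := π '' {j : Fin n | (j : ℕ) < i}

theorem mem_prefixSet {π : Equiv.Perm (Fin n)} {i : ℕ} {k : Fin n} :
    k ∈ prefixSet π i ↔ (π.symm k : ℕ) < i := by
  constructor
  · rintro ⟨j, hj, rfl⟩
    simpa using hj
  · intro h
    exact ⟨π.symm k, h, by simp⟩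

theorem prefixSet_mono (π : Equiv.Perm (Fin n)) : Monotone (prefixSet π) := fun _ _ h _ hk =>
  mem_prefixSet.2 ((mem_prefixSet.1 hk).trans_le h)

theorem prefixSet_zero (π : Equiv.Perm (Fin n)) : prefixSet π 0 = ∅ := by
  ext k; simp [mem_prefixSet]

theorem prefixSet_self (π : Equiv.Perm (Fin n)) : prefixSet π n = univ := by
  ext k; simp [mem_prefixSet]

theorem prefixSet_succ (π : Equiv.Perm (Fin n)) (j : Fin n) :
    prefixSet π (j + 1) = insert (π j) (prefixSet π j) := by
  ext k
  rw [mem_insert_iff, mem_prefixSet, mem_prefixSet, ← Equiv.symm_apply_eq, Fin.ext_iff]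
  omega

theorem notMem_prefixSet (π : Equiv.Perm (Fin n)) (j : Fin n) : π j ∉ prefixSet π j := by
  simp [mem_prefixSet]

theorem sigma_eq (f : (Fin n → ℝ) → ℝ) (π : Equiv.Perm (Fin n)) (k : Fin n) :
    sigma f π k = setFun f (prefixSet π ((π.symm k : ℕ) + 1)) -
      setFun f (prefixSet π (π.symm k : ℕ)) := rfl

theorem indicator_mem_cube (S : Set (Fin n)) : S.indicator 1 ∈ cube n := fun i => by
  by_cases h : i ∈ S <;> simp [h]

theorem exists_indicator_eq {x : Fin n → ℝ} (hx : x ∈ cube n) :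
    ∃ S : Set (Fin n), x = S.indicator 1 := by
  refine ⟨{i | x i = 1}, funext fun i => ?_⟩
  rcases hx i with h | h <;> simp [indicator, h]

theorem indicator_one_injective :
    Function.Injective fun S : Set (Fin n) => (S.indicator 1 : Fin n → ℝ) := fun S T h => by
  ext i
  have := congrFun h i
  by_cases h₁ : i ∈ S <;> by_cases h₂ : i ∈ T <;> simp_all

theorem indicator_mem_chain {π : Equiv.Perm (Fin n)} {S : Set (Fin n)} :
    S.indicator 1 ∈ chain π ↔ ∃ i ≤ n, S = prefixSet π i := by
  constructor
  · rintro ⟨i, hi, h⟩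
    exact ⟨i, hi, indicator_one_injective h⟩
  · rintro ⟨i, hi, rfl⟩
    exact ⟨i, hi, rfl⟩

theorem chain_subset_cube (π : Equiv.Perm (Fin n)) : chain π ⊆ cube n := by
  rintro _ ⟨i, -, rfl⟩
  exact indicator_mem_cube _

theorem Submodular.setFun {f : (Fin n → ℝ) → ℝ} (hf : Submodular f) (S T : Set (Fin n)) :
    setFun f (S ∪ T) + setFun f (S ∩ T) ≤ setFun f S + setFun f T := by
  have h := hf _ (indicator_mem_cube S) _ (indicator_mem_cube T)
  have h₁ : (S.indicator 1 ⊔ T.indicator 1 : Fin n → ℝ) = (S ∪ T).indicator 1 := by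
    ext i
    by_cases h₁ : i ∈ S <;> by_cases h₂ : i ∈ T <;> simp [h₁, h₂]
  have h₂ : (S.indicator 1 ⊓ T.indicator 1 : Fin n → ℝ) = (S ∩ T).indicator 1 := by
    ext i
    by_cases h₁ : i ∈ S <;> by_cases h₂ : i ∈ T <;> simp [h₁, h₂]
  rwa [h₁, h₂] at h

/-! ### Strict submodularity from injectivity of `sigma f`. -/

/-- Any set followed by two further elements is an initial segment of some permutation. -/
theorem exists_perm_prefixSet {A : Set (Fin n)} {k l : Fin n} (hk : k ∉ A) (hl : l ∉ A)
    (hkl : k ≠ l) :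
    ∃ π : Equiv.Perm (Fin n), prefixSet π (π.symm k) = A ∧ (π.symm l : ℕ) = π.symm k + 1 := by
  classical
  -- Sorting by `key` lists `A`, then `k`, then `l`, then the rest.
  let key : Fin n → ℕ := fun a => if a ∈ A then 0 else if a = k then 1 else if a = l then 2 else 3
  let π := Tuple.sort key
  have hm : ∀ a b : Fin n, π.symm a ≤ π.symm b → key a ≤ key b := fun a b h => by
    simpa [π] using Tuple.monotone_sort key h
  have hlt : ∀ a b : Fin n, key a < key b → π.symm a < π.symm b := fun a b h => by
    by_contra! hc
    exact absurd (hm _ _ hc) (not_le.2 h)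
  have key_k : key k = 1 := by simp [key, hk]
  have key_l : key l = 2 := by simp [key, hl, hkl.symm]
  have key_A : ∀ a ∈ A, key a = 0 := fun a ha => by simp [key, ha]
  have key_le_one : ∀ a, key a ≤ 1 → a ∈ A ∨ a = k := fun a h => by
    simp only [key] at h; split_ifs at h <;> simp_all
  have key_le_two : ∀ a, key a ≤ 2 → a ∈ A ∨ a = k ∨ a = l := fun a h => by
    simp only [key] at h; split_ifs at h <;> simp_all
  have hpos : π.symm k < π.symm l := hlt _ _ (by omega)
  refine ⟨π, ?_, ?_⟩
  · ext a
    rw [mem_prefixSet, Fin.val_fin_lt]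
    constructor
    · intro h
      rcases key_le_one a ((hm _ _ h.le).trans key_k.le) with h' | rfl
      · exact h'
      · exact absurd h (lt_irrefl _)
    · intro h
      exact hlt _ _ (by rw [key_A a h]; omega)
  · by_contra hne
    have hlt' : (π.symm k : ℕ) + 1 < π.symm l := by
      have : (π.symm k : ℕ) < π.symm l := hpos
      omega
    let p : Fin n := ⟨π.symm k + 1, hlt'.trans (π.symm l).2⟩
    have hp : π.symm (π p) = p := by simp
    rcases key_le_two (π p) ((hm _ l (by rw [hp]; exact hlt'.le)).trans key_l.le) with h | h | h
    · have h1 := hlt (π p) k (by rw [key_A _ h]; omega)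
      rw [hp, Fin.lt_def] at h1
      simp only [p] at h1
      omega
    · have h1 : p = π.symm k := by rw [← h, hp]
      have := congrArg Fin.val h1
      simp only [p] at this
      omega
    · have h1 : p = π.symm l := by rw [← h, hp]
      have := congrArg Fin.val h1
      simp only [p] at this
      omega

/-- If `f` were modular on this square, exchanging the consecutive values `k` and `l` after `A`
would give another permutation with the same `sigma`. -/
theorem setFun_square_ne {f : (Fin n → ℝ) → ℝ} (hinj : Function.Injective (sigma f))
    {A : Set (Fin n)} {k l : Fin n} (hk : k ∉ A) (hl : l ∉ A) (hkl : k ≠ l) :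
    setFun f (insert k (insert l A)) + setFun f A ≠
      setFun f (insert k A) + setFun f (insert l A) := by
  intro heq
  obtain ⟨π, hA, hpos⟩ := exists_perm_prefixSet hk hl hkl
  let ρ : Equiv.Perm (Fin n) := π.trans (Equiv.swap k l)
  have hρ : ∀ o, ρ.symm o = π.symm (Equiv.swap k l o) := fun o => by simp [ρ]
  have hAk : prefixSet π (π.symm k + 1) = insert k A := by rw [prefixSet_succ, hA]; simp
  have hAkl : prefixSet π (π.symm k + 1 + 1) = insert k (insert l A) := by
    rw [← hpos, prefixSet_succ, hpos, hAk, insert_comm]; simp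
  -- The exchange alters only the initial segment that contains one of `k`, `l` but not the other.
  have hsame : ∀ q : ℕ, q ≠ π.symm k + 1 → prefixSet ρ q = prefixSet π q := fun q hq => by
    ext o
    rw [mem_prefixSet, mem_prefixSet, hρ]
    by_cases h₁ : o = k
    · subst h₁; rw [Equiv.swap_apply_left]; omega
    by_cases h₂ : o = l
    · subst h₂; rw [Equiv.swap_apply_right]; omega
    rw [Equiv.swap_apply_of_ne_of_ne h₁ h₂]
  have hρk : (ρ.symm k : ℕ) = π.symm k + 1 := by rw [hρ, Equiv.swap_apply_left, hpos]
  have hρl : (ρ.symm l : ℕ) = π.symm k := by rw [hρ, Equiv.swap_apply_right]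
  have hAl : prefixSet ρ (π.symm k + 1) = insert l A := by
    rw [← hρl, prefixSet_succ, hρl, hsame _ (by omega), hA]; simp
  have hσ : sigma f ρ = sigma f π := by
    funext o
    rw [sigma_eq, sigma_eq]
    by_cases h₁ : o = k
    · subst h₁
      rw [hρk, hsame (_ + 1 + 1) (by omega), hAl, hAk, hAkl, hA]
      linarith
    by_cases h₂ : o = l
    · subst h₂
      rw [hρl, hpos, hAl, hsame _ (by omega), hAk, hAkl, hA]
      linarith
    have h₃ : (π.symm o : ℕ) ≠ π.symm k := fun h => h₁ (π.symm.injective (Fin.ext h))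
    have h₄ : (π.symm o : ℕ) ≠ π.symm l := fun h => h₂ (π.symm.injective (Fin.ext h))
    rw [hρ, Equiv.swap_apply_of_ne_of_ne h₁ h₂, hsame _ (by omega), hsame _ (by omega)]
  have := hinj hσ
  rw [this] at hρk
  omega

/-- Strictly diminishing returns under non-degeneracy. -/
theorem setFun_insert_lt {f : (Fin n → ℝ) → ℝ} (hf : Submodular f)
    (hinj : Function.Injective (sigma f)) {A B : Set (Fin n)} (hAB : A ⊂ B) {k : Fin n}
    (hk : k ∉ B) :
    setFun f (insert k B) + setFun f A < setFun f (insert k A) + setFun f B := by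
  obtain ⟨hsub, l, hlB, hlA⟩ := ssubset_iff_subset_not_subset.1 hAB |>.imp_right not_subset.1
  have hkA : k ∉ A := fun h => hk (hsub h)
  have hkl : k ≠ l := fun h => hk (h ▸ hlB)
  -- The gain of `k` drops strictly from `A` to `insert l A`, and weakly from there to `B`.
  have h₁ := hf.setFun (insert k A) (insert l A)
  have h₂ := hf.setFun (insert k (insert l A)) B
  have e₁ : insert k A ∪ insert l A = insert k (insert l A) := by
    ext o; simp only [mem_union, mem_insert_iff]; tauto
  have e₂ : insert k A ∩ insert l A = A := by
    ext o; simp only [mem_inter_iff, mem_insert_iff]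
    constructor
    · rintro ⟨rfl | h, h' | h'⟩
      exacts [absurd h' hkl, h', h, h]
    · tauto
  have e₃ : insert k (insert l A) ∪ B = insert k B := by
    rw [insert_union, union_eq_self_of_subset_left (insert_subset hlB hsub)]
  have e₄ : insert k (insert l A) ∩ B = insert l A := by
    rw [insert_inter_of_notMem hk, inter_eq_self_of_subset_left (insert_subset hlB hsub)]
  rw [e₁, e₂] at h₁
  rw [e₃, e₄] at h₂
  have h₃ := lt_of_le_of_ne h₁ (setFun_square_ne hinj hkA hlA hkl)
  linarith

/-! ### Greedy inequalities on the cube. -/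

theorem sum_sigma_indicator (f : (Fin n → ℝ) → ℝ) (π : Equiv.Perm (Fin n)) (S : Set (Fin n)) :
    ∑ k, sigma f π k * S.indicator 1 k = ∑ j, sigma f π (π j) * S.indicator 1 (π j) :=
  (Equiv.sum_comp π fun k => sigma f π k * S.indicator 1 k).symm

theorem setFun_eq_sum {f : (Fin n → ℝ) → ℝ} (h0 : f 0 = 0) (π : Equiv.Perm (Fin n))
    (S : Set (Fin n)) :
    setFun f S = ∑ j : Fin n,
      (setFun f (S ∩ prefixSet π (j + 1)) - setFun f (S ∩ prefixSet π j)) := by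
  rw [Fin.sum_univ_eq_sum_range
    (fun j => setFun f (S ∩ prefixSet π (j + 1)) - setFun f (S ∩ prefixSet π j)) n,
    Finset.sum_range_sub fun j => setFun f (S ∩ prefixSet π j), prefixSet_self, prefixSet_zero]
  simp only [setFun, inter_univ, inter_empty, indicator_empty']
  rw [h0, sub_zero]

theorem inter_prefixSet_succ_of_notMem {π : Equiv.Perm (Fin n)} {S : Set (Fin n)} {j : Fin n}
    (h : π j ∉ S) : S ∩ prefixSet π (j + 1) = S ∩ prefixSet π j := by
  rw [prefixSet_succ, inter_insert_of_notMem h]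

theorem sigma_apply_eq (f : (Fin n → ℝ) → ℝ) (π : Equiv.Perm (Fin n)) (j : Fin n) :
    sigma f π (π j) = setFun f (prefixSet π (j + 1)) - setFun f (prefixSet π j) :=
  sigma_apply f π j

/-- Diminishing returns: the gain of `π j` over the whole initial segment is at most its gain over
the part inside `S`. Summed over `j`, the right side telescopes to `setFun f S`. -/
theorem sigma_mul_le {f : (Fin n → ℝ) → ℝ} (hf : Submodular f) (π : Equiv.Perm (Fin n))
    (S : Set (Fin n)) (j : Fin n) :
    sigma f π (π j) * S.indicator 1 (π j) ≤
      setFun f (S ∩ prefixSet π (j + 1)) - setFun f (S ∩ prefixSet π j) := by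
  by_cases h : π j ∈ S
  · have h₁ := hf.setFun (S ∩ prefixSet π (j + 1)) (prefixSet π j)
    have e₁ : S ∩ prefixSet π (j + 1) ∪ prefixSet π j = prefixSet π (j + 1) := by
      rw [prefixSet_succ]; ext o; simp only [mem_union, mem_inter_iff, mem_insert_iff]
      constructor
      · tauto
      · rintro (rfl | h') <;> tauto
    have e₂ : S ∩ prefixSet π (j + 1) ∩ prefixSet π j = S ∩ prefixSet π j := by
      rw [inter_assoc, inter_eq_self_of_subset_right (prefixSet_mono π (Nat.le_succ _))]
    rw [e₁, e₂] at h₁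
    rw [sigma_apply_eq, indicator_of_mem h, Pi.one_apply]
    linarith
  · rw [inter_prefixSet_succ_of_notMem h]
    simp [h]

theorem sum_sigma_le {f : (Fin n → ℝ) → ℝ} (hf : Submodular f) (h0 : f 0 = 0)
    (π : Equiv.Perm (Fin n)) {x : Fin n → ℝ} (hx : x ∈ cube n) :
    ∑ k, sigma f π k * x k ≤ f x := by
  obtain ⟨S, rfl⟩ := exists_indicator_eq hx
  change _ ≤ setFun f S
  rw [sum_sigma_indicator, setFun_eq_sum h0 π S]
  exact Finset.sum_le_sum fun j _ => sigma_mul_le hf π S j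

theorem sum_sigma_eq {f : (Fin n → ℝ) → ℝ} (h0 : f 0 = 0)
    {π : Equiv.Perm (Fin n)} {x : Fin n → ℝ} (hx : x ∈ chain π) :
    ∑ k, sigma f π k * x k = f x := by
  obtain ⟨S, rfl⟩ := exists_indicator_eq (chain_subset_cube π hx)
  obtain ⟨i, -, rfl⟩ := indicator_mem_chain.1 hx
  change _ = setFun f (prefixSet π i)
  rw [sum_sigma_indicator, setFun_eq_sum h0 π]
  refine Finset.sum_congr rfl fun j _ => ?_
  by_cases h : π j ∈ prefixSet π i
  · have hj : (j : ℕ) + 1 ≤ i := by simpa [mem_prefixSet] using h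
    rw [sigma_apply_eq, indicator_of_mem h,
      inter_eq_self_of_subset_right (prefixSet_mono π hj),
      inter_eq_self_of_subset_right (prefixSet_mono π ((Nat.le_succ _).trans hj))]
    simp
  · rw [inter_prefixSet_succ_of_notMem h]
    simp [h]

/-- A set that is not an initial segment of `π` contains some `π j` but not all earlier values. -/
theorem exists_not_prefixSet_subset {π : Equiv.Perm (Fin n)} {S : Set (Fin n)}
    (hS : S.indicator 1 ∉ chain π) : ∃ j, π j ∈ S ∧ ¬ prefixSet π j ⊆ S := by
  by_contra! hc
  -- By `hc`, `S` contains all values preceding any of its elements, so it is comparable with every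
  -- initial segment.
  have key : ∀ i ≤ n, ¬ prefixSet π i ⊆ S → S ⊆ prefixSet π i := by
    intro i _ h k hk
    by_contra hk'
    rw [mem_prefixSet, not_lt] at hk'
    exact h ((prefixSet_mono π hk').trans (hc (π.symm k) (by simpa using hk)))
  have all : ∀ i ≤ n, prefixSet π i ⊆ S := by
    intro i
    induction i with
    | zero => simp [prefixSet_zero]
    | succ i ih =>
      intro hi
      by_contra h
      refine hS (indicator_mem_chain.2 ⟨i, by omega, Subset.antisymm ?_ (ih (by omega))⟩)
      intro k hk
      have hk' := key _ hi h hk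
      have hs := prefixSet_succ π ⟨i, hi⟩
      simp only at hs
      rw [hs] at hk' h
      rcases hk' with rfl | hk'
      · exact absurd (insert_subset hk (ih (by omega))) h
      · exact hk'
  refine hS (indicator_mem_chain.2 ⟨n, le_rfl, Subset.antisymm ?_ (all n le_rfl)⟩)
  rw [prefixSet_self]
  exact subset_univ _

theorem sum_sigma_lt {f : (Fin n → ℝ) → ℝ} (hf : Submodular f) (h0 : f 0 = 0)
    (hinj : Function.Injective (sigma f)) {π : Equiv.Perm (Fin n)} {x : Fin n → ℝ}
    (hx : x ∈ cube n) (hxπ : x ∉ chain π) :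
    ∑ k, sigma f π k * x k < f x := by
  obtain ⟨S, rfl⟩ := exists_indicator_eq hx
  change _ < setFun f S
  rw [sum_sigma_indicator, setFun_eq_sum h0 π S]
  obtain ⟨j, hj, hjS⟩ := exists_not_prefixSet_subset hxπ
  refine Finset.sum_lt_sum (fun j _ => sigma_mul_le hf π S j) ⟨j, Finset.mem_univ _, ?_⟩
  have h := setFun_insert_lt hf hinj (A := S ∩ prefixSet π j) (B := prefixSet π j)
    ⟨inter_subset_right, fun h => hjS fun k hk => (h hk).1⟩ (notMem_prefixSet π j)
  rw [sigma_apply_eq, indicator_of_mem hj, Pi.one_apply, prefixSet_succ, inter_insert_of_mem hj]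
  linarith

/-! ### Topology and convexity of `C(P)`. -/

theorem continuous_sum_sigma (f : (Fin n → ℝ) → ℝ) (π : Equiv.Perm (Fin n)) :
    Continuous fun p : (Fin n → ℝ) × ℝ => ∑ k, sigma f π k * p.1 k := by
  fun_prop

theorem isClosed_polyC (f : (Fin n → ℝ) → ℝ) (P : Set (Equiv.Perm (Fin n))) :
    IsClosed (polyC f P) := by
  simp only [polyC, ofPred_forall]
  exact isClosed_biInter fun π _ => isClosed_le (continuous_sum_sigma f π) continuous_snd

theorem sum_sigma_combo (f : (Fin n → ℝ) → ℝ) (π : Equiv.Perm (Fin n)) (x y : Fin n → ℝ)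
    (a b : ℝ) : ∑ k, sigma f π k * (a • x + b • y) k =
      a * ∑ k, sigma f π k * x k + b * ∑ k, sigma f π k * y k := by
  simp only [Pi.add_apply, Pi.smul_apply, smul_eq_mul, Finset.mul_sum, ← Finset.sum_add_distrib]
  exact Finset.sum_congr rfl fun k _ => by ring

theorem convex_polyC (f : (Fin n → ℝ) → ℝ) (P : Set (Equiv.Perm (Fin n))) :
    Convex ℝ (polyC f P) := by
  intro p hp q hq a b ha hb _ π hπ
  have h₁ := mul_le_mul_of_nonneg_left (hp π hπ) ha
  have h₂ := mul_le_mul_of_nonneg_left (hq π hπ) hb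
  simp only [Prod.fst_add, Prod.smul_fst, Prod.snd_add, Prod.smul_snd, sum_sigma_combo,
    smul_eq_mul]
  linarith

theorem mem_interior_polyC {f : (Fin n → ℝ) → ℝ} {P : Set (Equiv.Perm (Fin n))}
    {p : (Fin n → ℝ) × ℝ} :
    p ∈ interior (polyC f P) ↔ ∀ π ∈ P, ∑ k, sigma f π k * p.1 k < p.2 := by
  constructor
  · intro hp π hπ
    -- An interior point can be moved slightly down in the `t` direction, which makes each
    -- inequality strict.
    have hc : Tendsto (fun t : ℝ => (p.1, t)) (𝓝[<] p.2) (𝓝 p) :=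
      ((Continuous.prodMk_right p.1).tendsto p.2).mono_left nhdsWithin_le_nhds
    obtain ⟨t, ht, htp⟩ :=
      ((hc.eventually (mem_interior_iff_mem_nhds.1 hp)).and self_mem_nhdsWithin).exists
    exact (ht π hπ).trans_lt htp
  · intro hp
    rw [mem_interior_iff_mem_nhds]
    have h : ∀ᶠ q in 𝓝 p, ∀ π ∈ P, ∑ k, sigma f π k * q.1 k < q.2 :=
      (eventually_all_finite P.toFinite).2 fun π hπ =>
        (continuous_sum_sigma f π).continuousAt.eventually_lt continuous_snd.continuousAt
          (hp π hπ)
    filter_upwards [h] with q hq π hπ using (hq π hπ).le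

/-! ### Covers and freeness. -/

theorem IsCover.exists_mem_chain {P : Set (Equiv.Perm (Fin n))} (hP : IsCover P)
    {x : Fin n → ℝ} (hx : x ∈ cube n) : ∃ π ∈ P, x ∈ chain π := by
  rw [← hP] at hx
  simpa using hx

theorem isCover_of_forall {P : Set (Equiv.Perm (Fin n))}
    (h : ∀ x ∈ cube n, ∃ π ∈ P, x ∈ chain π) : IsCover P :=
  Subset.antisymm (iUnion₂_subset fun π _ => chain_subset_cube π) fun x hx => by
    simpa using h x hx

theorem IsCover.isFree {f : (Fin n → ℝ) → ℝ} (h0 : f 0 = 0) {P : Set (Equiv.Perm (Fin n))}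
    (hP : IsCover P) : IsFree (hypograph (cube n) f) (polyC f P) := by
  refine ⟨isClosed_polyC f P, convex_polyC f P, eq_empty_of_forall_notMem ?_⟩
  rintro p ⟨hp, hx, ht⟩
  obtain ⟨π, hπ, hxπ⟩ := hP.exists_mem_chain hx
  have := mem_interior_polyC.1 hp π hπ
  rw [sum_sigma_eq h0 hxπ] at this
  exact absurd ht (not_le.2 this)

theorem IsFree.isCover {f : (Fin n → ℝ) → ℝ} (hf : Submodular f) (h0 : f 0 = 0)
    (hinj : Function.Injective (sigma f)) {P : Set (Equiv.Perm (Fin n))}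
    (hP : IsFree (hypograph (cube n) f) (polyC f P)) : IsCover P := by
  refine isCover_of_forall fun x hx => ?_
  by_contra! hc
  have : (x, f x) ∈ interior (polyC f P) ∩ hypograph (cube n) f :=
    ⟨mem_interior_polyC.2 fun π hπ => sum_sigma_lt hf h0 hinj hx (hc π hπ), hx, le_rfl⟩
  rw [hP.2.2] at this
  exact this

/-! ### Irredundancy. -/

/-- Consecutive chain points differ by a unit vector, so the values on the chain determine every
coordinate. -/
theorem sigma_eq_of_forall_chainPt {f : (Fin n → ℝ) → ℝ} {π ρ : Equiv.Perm (Fin n)}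
    (h : ∀ i ≤ n, ∑ k, sigma f ρ k * chainPt π i k = ∑ k, sigma f π k * chainPt π i k) :
    sigma f ρ = sigma f π := by
  have step : ∀ (j : Fin n) (τ : Equiv.Perm (Fin n)), sigma f τ (π j) =
      ∑ k, sigma f τ k * chainPt π (j + 1) k - ∑ k, sigma f τ k * chainPt π j k := by
    intro j τ
    rw [← Finset.sum_sub_distrib, Finset.sum_eq_single (π j)]
    · have h₁ : chainPt π (j + 1) (π j) = 1 :=
        indicator_of_mem (s := prefixSet π (j + 1)) (by simp [mem_prefixSet]) 1
      have h₂ : chainPt π j (π j) = 0 :=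
        indicator_of_notMem (s := prefixSet π j) (notMem_prefixSet π j) 1
      rw [h₁, h₂]; ring
    · intro k _ hk
      have : chainPt π (j + 1) k = chainPt π j k := by
        change (prefixSet π (j + 1)).indicator 1 k = (prefixSet π j).indicator 1 k
        rw [prefixSet_succ]
        by_cases h' : k ∈ prefixSet π j <;> simp [indicator, hk, h']
      rw [this, sub_self]
    · simp
  funext k
  have h₁ := step (π.symm k) ρ
  have h₂ := step (π.symm k) π
  rw [h _ (π.symm k).2, h _ (π.symm k).2.le, ← h₂] at h₁
  simpa using h₁

/-- Under non-degeneracy some point is strictly maximized by `σ(π)` among all `σ(ρ)`. -/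
theorem exists_forall_sum_sigma_lt {f : (Fin n → ℝ) → ℝ} (hf : Submodular f) (h0 : f 0 = 0)
    (hinj : Function.Injective (sigma f)) (π : Equiv.Perm (Fin n)) :
    ∃ x : Fin n → ℝ, ∀ ρ ≠ π, ∑ k, sigma f ρ k * x k < ∑ k, sigma f π k * x k := by
  -- `σ(π)` is weakly best at each chain point of `π`; a tie at their sum is a tie at all of them.
  refine ⟨∑ i ∈ Finset.range (n + 1), chainPt π i, fun ρ hρ => ?_⟩
  have expand : ∀ τ : Equiv.Perm (Fin n),
      ∑ k, sigma f τ k * (∑ i ∈ Finset.range (n + 1), chainPt π i) k =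
        ∑ i ∈ Finset.range (n + 1), ∑ k, sigma f τ k * chainPt π i k := fun τ => by
    simp only [Finset.sum_apply, Finset.mul_sum]
    exact Finset.sum_comm
  have hle : ∀ i ≤ n, ∑ k, sigma f ρ k * chainPt π i k ≤ ∑ k, sigma f π k * chainPt π i k :=
    fun i hi => by
      rw [sum_sigma_eq h0 (π := π) ⟨i, hi, rfl⟩]
      exact sum_sigma_le hf h0 ρ (indicator_mem_cube _)
  rw [expand, expand]
  refine Finset.sum_lt_sum (fun i hi => hle i (by simpa [Nat.lt_succ_iff] using hi)) ?_
  by_contra! hc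
  exact hρ (hinj (sigma_eq_of_forall_chainPt fun i hi =>
    (hle i hi).antisymm (hc i (by simpa [Nat.lt_succ_iff] using hi))))

/-- Under non-degeneracy every inequality of `C(P)` is irredundant. -/
theorem polyC_ne_of_mem {f : (Fin n → ℝ) → ℝ} (hf : Submodular f) (h0 : f 0 = 0)
    (hinj : Function.Injective (sigma f)) {P : Set (Equiv.Perm (Fin n))}
    {π : Equiv.Perm (Fin n)} (hπ : π ∈ P) : polyC f (P \ {π}) ≠ polyC f P := by
  intro heq
  obtain ⟨x, hx⟩ := exists_forall_sum_sigma_lt hf h0 hinj π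
  have h : ∀ᶠ t in 𝓝[<] (∑ k, sigma f π k * x k), ∀ ρ ∈ P \ {π}, ∑ k, sigma f ρ k * x k < t :=
    (eventually_all_finite (P \ {π}).toFinite).2 fun ρ hρ =>
      nhdsWithin_le_nhds (lt_mem_nhds (hx ρ hρ.2))
  obtain ⟨t, ht, hlt⟩ := (h.and self_mem_nhdsWithin).exists
  have hmem : (x, t) ∈ polyC f (P \ {π}) := fun ρ hρ => (ht ρ hρ).le
  rw [heq] at hmem
  exact absurd (hmem π hπ) (not_le.2 hlt)

/-! ### Maximality and minimal covers. -/

theorem IsMaximallyFree.isMinimalCover {f : (Fin n → ℝ) → ℝ} (hf : Submodular f) (h0 : f 0 = 0)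
    (hinj : Function.Injective (sigma f)) {P : Set (Equiv.Perm (Fin n))}
    (hP : IsMaximallyFree (hypograph (cube n) f) (polyC f P)) : IsMinimalCover P := by
  have hcov := hP.1.isCover hf h0 hinj
  refine ⟨hcov, fun π hπ => ?_⟩
  by_contra hne
  rw [not_nonempty_iff_eq_empty, sdiff_eq_empty] at hne
  refine polyC_ne_of_mem hf h0 hinj hπ (hP.2 _ (IsCover.isFree h0 (isCover_of_forall ?_))
    fun p hp ρ hρ => hp ρ hρ.1)
  intro x hx
  obtain ⟨ρ, hρ, hxρ⟩ := hcov.exists_mem_chain hx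
  by_cases h : ρ = π
  · subst h
    obtain ⟨τ, ⟨hτ, hτρ⟩, hxτ⟩ := mem_iUnion₂.1 (hne hxρ)
    exact ⟨τ, ⟨hτ, hτρ⟩, hxτ⟩
  · exact ⟨ρ, ⟨hρ, h⟩, hxρ⟩

theorem IsMinimalCover.isMaximallyFree {f : (Fin n → ℝ) → ℝ} (hf : Submodular f) (h0 : f 0 = 0)
    (hinj : Function.Injective (sigma f)) {P : Set (Equiv.Perm (Fin n))}
    (hP : IsMinimalCover P) : IsMaximallyFree (hypograph (cube n) f) (polyC f P) := by
  refine ⟨hP.1.isFree h0, fun C' hC' hsub => Subset.antisymm (fun p hp => ?_) hsub⟩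
  by_contra hpC
  obtain ⟨π, hπ, hpπ⟩ : ∃ π ∈ P, p.2 < ∑ k, sigma f π k * p.1 k := by
    simpa [polyC] using hpC
  obtain ⟨v, hv, hvP⟩ := hP.2 π hπ
  have hcube := chain_subset_cube π hv
  -- `q ε` lies on the line from `p` through `(v, f v)`, just beyond it. At `(v, f v)` only the
  -- inequality of `π` is tight, and moving away from `p` makes it strict, so `q ε` is interior to
  -- `C(P)` for small `ε > 0`. Convexity of `C'` then makes `(v, f v)` interior to `C'`.
  let q : ℝ → (Fin n → ℝ) × ℝ := fun ε => (1 + ε) • (v, f v) + (-ε) • p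
  have hq : ∀ (ρ : Equiv.Perm (Fin n)) (ε : ℝ), ∑ k, sigma f ρ k * (q ε).1 k =
      (1 + ε) * ∑ k, sigma f ρ k * v k + -ε * ∑ k, sigma f ρ k * p.1 k := fun ρ ε => by
    simp only [q, Prod.fst_add, Prod.smul_fst]
    rw [sum_sigma_combo]
  have hqc : Continuous q := by fun_prop
  have hev : ∀ᶠ ε in 𝓝[>] (0 : ℝ), ∀ ρ ∈ P \ {π}, ∑ k, sigma f ρ k * (q ε).1 k < (q ε).2 := by
    refine (eventually_all_finite (P \ {π}).toFinite).2 fun ρ hρ => nhdsWithin_le_nhds ?_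
    refine ((continuous_sum_sigma f ρ).comp hqc).continuousAt.eventually_lt
      (continuous_snd.comp hqc).continuousAt ?_
    have hlt := sum_sigma_lt hf h0 hinj hcube (π := ρ) fun h =>
      hvP (mem_iUnion₂.2 ⟨ρ, ⟨hρ.1, hρ.2⟩, h⟩)
    simpa [q] using hlt
  obtain ⟨ε, hε, hε0⟩ := (hev.and self_mem_nhdsWithin).exists
  have hε0 : 0 < ε := hε0
  have hqi : q ε ∈ interior (polyC f P) := by
    refine mem_interior_polyC.2 fun ρ hρ => ?_
    by_cases h : ρ = π
    · subst h
      rw [hq, sum_sigma_eq h0 hv]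
      have : (q ε).2 = (1 + ε) * f v + -ε * p.2 := by simp [q]
      rw [this]
      have := mul_lt_mul_of_pos_left hpπ hε0
      linarith
    · exact hε ρ ⟨hρ, h⟩
  have hseg : (v, f v) ∈ openSegment ℝ (q ε) p := by
    refine ⟨(1 + ε)⁻¹, ε * (1 + ε)⁻¹, by positivity, by positivity, by field_simp, ?_⟩
    have h1 : (1 + ε)⁻¹ * (1 + ε) = 1 := inv_mul_cancel₀ (by positivity)
    simp only [q, smul_add, smul_smul, h1, one_smul, add_assoc, ← add_smul]
    rw [show (1 + ε)⁻¹ * -ε + ε * (1 + ε)⁻¹ = 0 by ring, zero_smul, add_zero]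
  have hmem : (v, f v) ∈ interior C' ∩ hypograph (cube n) f :=
    ⟨hC'.2.1.openSegment_interior_self_subset_interior (interior_mono hsub hqi) hp hseg,
      hcube, le_rfl⟩
  rw [hC'.2.2] at hmem
  exact hmem

end SubmodCut

theorem mainTheorem2 {n : ℕ} (f : (Fin n → ℝ) → ℝ)
    (hf : SubmodCut.Submodular f) (h0 : f 0 = 0) (P : Set (Equiv.Perm (Fin n))) :
    (SubmodCut.IsCover P →
      SubmodCut.IsFree (SubmodCut.hypograph (SubmodCut.cube n) f) (SubmodCut.polyC f P)) ∧
    (Function.Injective (SubmodCut.sigma f) →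
      (SubmodCut.IsFree (SubmodCut.hypograph (SubmodCut.cube n) f) (SubmodCut.polyC f P) ↔
        SubmodCut.IsCover P) ∧
      (SubmodCut.IsMaximallyFree (SubmodCut.hypograph (SubmodCut.cube n) f)
          (SubmodCut.polyC f P) ↔
        SubmodCut.IsMinimalCover P)) :=
  ⟨fun hP => hP.isFree h0, fun hinj =>
    ⟨⟨fun h => h.isCover hf h0 hinj, fun hP => hP.isFree h0⟩,
      ⟨fun h => h.isMinimalCover hf h0 hinj, fun hP => hP.isMaximallyFree hf h0 hinj⟩⟩⟩
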